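/- For every constant $K$ there is a constant $C>0$, depending only on $K$, such that the following holds. Let $G=(V,E)$ be a finite, simple, undirected, connected graph with $n=|V|\ge 2$ vertices, minimum degree $\delta$ and maximum degree $\Delta\le K\delta$. Then $$\mathbb{E}[\mathrm{RBA}(G)] \;\le\; C\cdot\Bigl(\frac{1}{\delta}\cdot \mathsf{BLA}(G)+\frac{n^2}{\delta^2}\cdot\log^2 n\Bigr).$$ Here $\mathbb{E}[\mathrm{RBA}(G)]:=\max_{s\in V}\mathbb{E}\bigl[\min\{t\in\mathbb{N}: I_t=V\}\bigr]$ is the expected runtime of the push algorithm: $I_0=\{s\}$, and in each time step every vertex informed so far chooses, independently, one of its neighbours uniformly at random and informs it; $I_t$ is the set of vertices informed at time $t$. The blanket time is $\mathsf{BLA}(G):=\max_{s\in V}\mathbb{E}\bigl[\min\{t\in\mathbb{N}: \forall u\in V,\ \tfrac12 t\,\pi(u)\le W_t(s,u)\le 2t\,\pi(u)\}\bigr]$, where $X_0=s,X_1,X_2,\dots$ is the simple random walk on $G$ (each step goes to a uniformly random neighbour of the current vertex), $W_t(s,u)=|\{0\le t'\le t: X_{t'}=u\}|$ is the number of visits to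 $u$ up to time $t$, and $\pi(u)=\deg(u)/(2|E|)$. -/

import Mathlib

open MeasureTheory
open scoped ENNReal

noncomputable section

namespace PushBroadcast

variable {V : Type*} [Fintype V] [DecidableEq V]

/-- The uniform distribution on the neighbours of `v` (an isolated vertex selects itself, so that
the definition is total). -/
def neighborPMF (G : SimpleGraph V) [DecidableRel G.Adj] (v : V) : PMF V :=
  if h : (G.neighborFinset v).Nonempty then PMF.uniformOfFinset (G.neighborFinset v) h
  else PMF.pure v

/-- Outcomes: `ω (t, v)` is the neighbour selected by the vertex `v` in the step from time `t` to
time `t + 1`. -/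
abbrev Choices (V : Type*) : Type _ := ℕ × V → V

/-- The sigma-algebra on the outcomes: the product of the discrete ones. -/
instance choicesMeasurableSpace : MeasurableSpace (Choices V) :=
  @MeasurableSpace.pi (ℕ × V) (fun _ => V) (fun _ => ⊤)

/-- The law of the selections: all of them are independent, and each selection of `v` is uniform
on the neighbours of `v`. -/
def choiceMeasure (G : SimpleGraph V) [DecidableRel G.Adj] : Measure (Choices V) :=
  letI : MeasurableSpace V := ⊤
  Measure.infinitePi fun p : ℕ × V => (neighborPMF G p.2).toMeasure

/-- The first time at which `p` holds, `∞` if there is none. -/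
def firstTime (p : ℕ → Prop) : ℝ≥0∞ := ⨅ (t : ℕ) (_ : p t), (t : ℝ≥0∞)

/-- The set `I_t` of informed vertices in the push algorithm started from `s`: in every step each
informed vertex informs the neighbour that it selects. -/
def informed (s : V) (ω : Choices V) : ℕ → Finset V
  | 0 => {s}
  | t + 1 => informed s ω t ∪ (informed s ω t).image fun u => ω (t, u)

/-- The expected time until the push algorithm has informed all vertices, for the worst initial
vertex. -/
def expectedBroadcastTime (G : SimpleGraph V) [DecidableRel G.Adj] : ℝ≥0∞ :=
  ⨆ s : V, ∫⁻ ω, firstTime (fun t => informed s ω t = Finset.univ) ∂choiceMeasure G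

/-- The position `X_t` of the random walk started from `s`: in every step it moves to the
neighbour selected by its current position. The selections used in different steps are
independent, so this is the walk with transition probabilities `1 / deg`. -/
def walk (s : V) (ω : Choices V) : ℕ → V
  | 0 => s
  | t + 1 => ω (t, walk s ω t)

/-- The number of visits to `u` among the times `0, …, t`. -/
def visits (s : V) (ω : Choices V) (t : ℕ) (u : V) : ℕ :=
  ((Finset.range (t + 1)).filter fun t' => walk s ω t' = u).card

/-- The stationary distribution `deg u / (2 |E|)`. -/
def stationary (G : SimpleGraph V) [DecidableRel G.Adj] (u : V) : ℝ :=
  (G.degree u : ℝ) / (2 * (G.edgeFinset.card : ℝ))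

/-- At time `t` the number of visits to every vertex is within a factor of two of `t π(u)`. -/
def IsBlanket (G : SimpleGraph V) [DecidableRel G.Adj] (s : V) (ω : Choices V) (t : ℕ) : Prop :=
  ∀ u : V, 1 / 2 * ((t : ℝ) * stationary G u) ≤ (visits s ω t u : ℝ) ∧
    (visits s ω t u : ℝ) ≤ 2 * ((t : ℝ) * stationary G u)

/-- The blanket time of `G`: the expected first time at which the walk is blanket, for the worst
initial vertex. -/
def blanketTime (G : SimpleGraph V) [DecidableRel G.Adj] : ℝ≥0∞ :=
  ⨆ s : V, ∫⁻ ω, firstTime (IsBlanket G s ω) ∂choiceMeasure G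

end PushBroadcast

end

/-! The blanket time enters only as a lower bound on edge boundaries. A blanket walk has left every
proper subset `S`, so the mean exit time from `S` is at most BLA. Summing the Poisson equation of
the exit time over `S` with weights `deg` gives vol(S) ≤ BLA · e(S, Sᶜ). Adding the same bound for
`Sᶜ` shows that every cut has at least κ = nδ/(2 BLA) edges
(`card_mul_minDegree_le_blanketTime_mul`).

On the push side, enlarging the informed set `I` by δ/32 vertices, or finishing, takes mean time
O(δ/κ + log n), with constants depending on K (`spreadTime_le_of_gain`). Split the uninformed
vertices into `B`, with fewer than δ/8 uninformed neighbours, and the rest `U`. A vertex of `B` is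
informed with probability at least 1/(4K) per step, so a large `B` is enough by itself. If `B` is
small, `U` induces a graph of minimum degree at least δ/16, and one informed vertex in `U` starts
exponential growth there. If at least half of the boundary leads to `U`, such a vertex appears
within mean time O(1 + δ/κ). Otherwise half of `B` is informed in mean time O(K); unless `U` is
reached meanwhile, this shrinks the boundary by a constant factor, which can happen only O(log n)
times.

With O(n/δ) such gains the total is O((n/δ)(BLA/n + log n)), which is at most the claimed bound.
Every time estimate is a Lyapunov argument through `meanHit_le_of_drift`. -/

open MeasureTheory
open scoped ENNReal

set_option linter.unusedSectionVars false

noncomputable section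

namespace PushBroadcast

/-! ### Independent selections: splitting off the first step -/

section Bridge

variable {V : Type*}

/-- Prepend the selections `c` of one step to the selections `ω`. -/
def consChoices {X : Type*} (c : V → X) (ω : ℕ × V → X) : ℕ × V → X
  | (0, v) => c v
  | (t + 1, v) => ω (t, v)

theorem measurable_consChoices {X : Type*} [MeasurableSpace X] :
    Measurable fun z : (V → X) × (ℕ × V → X) => consChoices z.1 z.2 := by
  refine measurable_pi_lambda _ ?_
  rintro ⟨_ | t, v⟩
  · exact (measurable_pi_apply v).comp measurable_fst
  · exact (measurable_pi_apply (t, v)).comp measurable_snd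

/-- The Markov property in measure form: the marginals do not depend on time, so fresh selections
prepended to an independent copy have the original law. It suffices to compare finite-dimensional
boxes. -/
theorem map_consChoices_infinitePi [Fintype V] [DecidableEq V] {X : Type*} [MeasurableSpace X]
    (μ : V → Measure X) [∀ v, IsProbabilityMeasure (μ v)] :
    ((Measure.pi μ).prod (Measure.infinitePi fun p : ℕ × V => μ p.2)).map
      (fun z => consChoices z.1 z.2) = Measure.infinitePi fun p : ℕ × V => μ p.2 := by
  refine Measure.eq_infinitePi _ fun s t ht => ?_
  obtain ⟨N, hN⟩ : ∃ N, ∀ p ∈ s, p.1 < N + 1 := by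
    refine ⟨s.sup Prod.fst, fun p hp => Nat.lt_succ_of_le (Finset.le_sup (f := Prod.fst) hp)⟩
  -- Padding with `Set.univ` makes the box a full one over the times `0, …, N`, so that it factors
  -- into its time-0 layer and a shifted box.
  let t' : ℕ × V → Set X := fun p => if p ∈ s then t p else Set.univ
  have ht' : ∀ p, MeasurableSet (t' p) := fun p => by
    simp only [t']; split_ifs
    · exact ht p
    · exact MeasurableSet.univ
  have hset : (fun z : (V → X) × (ℕ × V → X) => consChoices z.1 z.2) ⁻¹' (Set.pi s t) =
      (Set.univ.pi fun v => t' (0, v)) ×ˢ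
        (Set.pi (Finset.range N ×ˢ Finset.univ : Finset (ℕ × V)) fun p => t' (p.1 + 1, p.2)) := by
    ext ⟨c, ω⟩
    simp only [Set.mem_preimage, Set.mem_pi, Set.mem_prod, Finset.mem_coe, Set.mem_univ,
      true_imp_iff, Finset.mem_product, Finset.mem_range, Finset.mem_univ, and_true, t']
    constructor
    · refine fun h => ⟨fun v => ?_, fun p _ => ?_⟩
      · split_ifs with hv
        · exact h _ hv
        · trivial
      · split_ifs with hv
        · exact h _ hv
        · trivial
    · rintro ⟨h0, h1⟩ ⟨_ | i, v⟩ hp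
      · have := h0 v
        rwa [if_pos hp] at this
      · have := h1 (i, v) (by have := hN _ hp; simp at this; exact this)
        rwa [if_pos hp] at this
  have hprod : ∏ p ∈ s, μ p.2 (t p) =
      ∏ p ∈ (Finset.range (N + 1) ×ˢ Finset.univ : Finset (ℕ × V)), μ p.2 (t' p) := by
    refine (Finset.prod_congr rfl fun p hp => by simp [t', hp]).trans
      (Finset.prod_subset (fun p hp => ?_) fun p _ hp => by simp [t', hp])
    simpa using Nat.lt_succ_iff.1 (hN p hp)
  rw [Measure.map_apply measurable_consChoices
    (MeasurableSet.pi s.countable_toSet fun p _ => ht p), hset, Measure.prod_prod,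
    Measure.pi_pi, Measure.infinitePi_pi _ (fun p _ => ht' _), hprod, Finset.prod_product,
    Finset.prod_product, Finset.prod_range_succ', mul_comm]

variable [Fintype V] [DecidableEq V]

/-- First-step analysis for arbitrary functionals; it yields the recursions for both `meanHit` and
`meanHitTrunc`. -/
theorem lintegral_choiceMeasure (G : SimpleGraph V) [DecidableRel G.Adj]
    {F : Choices V → ℝ≥0∞} (hF : Measurable F) :
    ∫⁻ ω, F ω ∂choiceMeasure G =
      ∑ c : V → V, (∏ v, neighborPMF G v (c v)) * ∫⁻ ω, F (consChoices c ω) ∂choiceMeasure G := by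
  let _ : MeasurableSpace V := ⊤
  have hm : Measurable fun z : (V → V) × (ℕ × V → V) => F (consChoices z.1 z.2) :=
    hF.comp measurable_consChoices
  have := map_consChoices_infinitePi fun v => (neighborPMF G v).toMeasure
  conv_lhs => rw [choiceMeasure, ← this]
  rw [lintegral_map hF measurable_consChoices, lintegral_prod _ hm.aemeasurable, lintegral_fintype]
  refine Finset.sum_congr rfl fun c _ => ?_
  rw [Measure.pi_singleton, mul_comm]
  congr 1
  refine Finset.prod_congr rfl fun v _ => ?_
  exact PMF.toMeasure_apply_singleton _ _ (MeasurableSet.singleton _)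

instance (G : SimpleGraph V) [DecidableRel G.Adj] : IsProbabilityMeasure (choiceMeasure G) := by
  let _ : MeasurableSpace V := ⊤
  unfold choiceMeasure
  infer_instance

theorem firstTime_of_zero {p : ℕ → Prop} (h : p 0) : firstTime p = 0 :=
  le_antisymm (iInf₂_le_of_le 0 h (by simp)) bot_le

theorem firstTime_succ {p : ℕ → Prop} (h : ¬ p 0) :
    firstTime p = 1 + firstTime fun t => p (t + 1) := by
  apply le_antisymm
  · unfold firstTime
    rw [ENNReal.add_iInf]
    refine le_iInf fun t => ?_
    by_cases ht : p (t + 1)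
    · simp only [ht, iInf_pos]
      exact iInf₂_le_of_le (t + 1) ht (by push_cast; rw [add_comm])
    · simp [ht]
  · refine le_iInf₂ fun t ht => ?_
    obtain _ | t := t
    · exact absurd ht h
    · push_cast
      rw [add_comm]
      exact add_le_add_left (iInf₂_le t ht) 1

theorem firstTime_le_firstTime {p q : ℕ → Prop} (h : ∀ t, p t → ∃ t' ≤ t, q t') :
    firstTime q ≤ firstTime p := by
  refine le_iInf₂ fun t ht => ?_
  obtain ⟨t', h1, h2⟩ := h t ht
  exact iInf₂_le_of_le t' h2 (by exact_mod_cast h1)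

/-! ### Hitting times of finite chains driven by the selections -/

variable {σ : Type*}

/-- The trajectory of the chain on `σ` with update rule `f`, driven by the selections `ω`. -/
def trajectory (f : σ → (V → V) → σ) (x : σ) (ω : Choices V) : ℕ → σ
  | 0 => x
  | t + 1 => f (trajectory f x ω t) fun v => ω (t, v)

theorem trajectory_consChoices (f : σ → (V → V) → σ) (x : σ) (c : V → V) (ω : Choices V) (t : ℕ) :
    trajectory f x (consChoices c ω) (t + 1) = trajectory f (f x c) ω t := by
  induction t with
  | zero => rfl
  | succ t ih => rw [trajectory, ih, trajectory]; rfl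

theorem measurable_trajectory [Finite σ] (f : σ → (V → V) → σ) (x : σ) (t : ℕ) :
    @Measurable _ _ _ ⊤ fun ω : Choices V => trajectory f x ω t := by
  let _ : MeasurableSpace V := ⊤
  let _ : MeasurableSpace σ := ⊤
  induction t with
  | zero => exact measurable_const
  | succ t ih =>
    have h1 : Measurable fun ω : Choices V => fun v => ω (t, v) :=
      measurable_pi_lambda _ fun v => measurable_pi_apply (t, v)
    have h2 : Measurable fun z : σ × (V → V) => f z.1 z.2 := measurable_of_countable _
    exact h2.comp (ih.prodMk h1)

theorem measurable_firstTime [Finite σ] (f : σ → (V → V) → σ) (A : Set σ) (x : σ) :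
    Measurable fun ω : Choices V => firstTime fun t => trajectory f x ω t ∈ A := by
  let _ : MeasurableSpace σ := ⊤
  unfold firstTime
  refine Measurable.iInf fun t => ?_
  have : (fun ω : Choices V => ⨅ (_ : trajectory f x ω t ∈ A), (t : ℝ≥0∞)) =
      (fun y => ⨅ (_ : y ∈ A), (t : ℝ≥0∞)) ∘ fun ω => trajectory f x ω t := rfl
  rw [this]
  exact (measurable_of_countable _).comp (measurable_trajectory f x t)

variable (G : SimpleGraph V) [DecidableRel G.Adj]

/-- The mean time until the chain with update rule `f` started from `x` hits `A`. -/
def meanHit (f : σ → (V → V) → σ) (A : Set σ) (x : σ) : ℝ≥0∞ :=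
  ∫⁻ ω, firstTime (fun t => trajectory f x ω t ∈ A) ∂choiceMeasure G

/-- The mean hitting time, truncated at `N`. -/
def meanHitTrunc (f : σ → (V → V) → σ) (A : Set σ) (N : ℕ) (x : σ) : ℝ≥0∞ :=
  ∫⁻ ω, min (firstTime fun t => trajectory f x ω t ∈ A) N ∂choiceMeasure G

variable {G}

theorem meanHit_of_mem {f : σ → (V → V) → σ} {A : Set σ} {x : σ} (hx : x ∈ A) :
    meanHit G f A x = 0 := by
  unfold meanHit
  simp_rw [firstTime_of_zero (p := fun t => trajectory f x _ t ∈ A) hx]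
  simp

theorem firstTime_trajectory_consChoices {f : σ → (V → V) → σ} {A : Set σ} {x : σ} (hx : x ∉ A)
    (c : V → V) (ω : Choices V) :
    firstTime (fun t => trajectory f x (consChoices c ω) t ∈ A) =
      1 + firstTime fun t => trajectory f (f x c) ω t ∈ A := by
  rw [firstTime_succ hx]
  simp_rw [trajectory_consChoices]

theorem sum_prod_neighborPMF : ∑ c : V → V, ∏ v, neighborPMF G v (c v) = 1 := by
  have h := Finset.prod_univ_sum (fun _ : V => (Finset.univ : Finset V)) fun v a => neighborPMF G v a
  rw [Fintype.piFinset_univ] at h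
  rw [← h]
  refine Finset.prod_eq_one fun v _ => ?_
  rw [← tsum_fintype (L := .unconditional _)]
  exact (neighborPMF G v).tsum_coe

theorem meanHit_of_notMem [Finite σ] {f : σ → (V → V) → σ} {A : Set σ} {x : σ} (hx : x ∉ A) :
    meanHit G f A x = 1 + ∑ c : V → V, (∏ v, neighborPMF G v (c v)) * meanHit G f A (f x c) := by
  rw [meanHit, lintegral_choiceMeasure G (measurable_firstTime f A x)]
  simp_rw [firstTime_trajectory_consChoices hx, lintegral_add_left measurable_const, mul_add,
    Finset.sum_add_distrib]
  simp [sum_prod_neighborPMF, meanHit]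

theorem meanHitTrunc_zero (f : σ → (V → V) → σ) (A : Set σ) (x : σ) :
    meanHitTrunc G f A 0 x = 0 := by
  simp [meanHitTrunc]

theorem meanHitTrunc_le_meanHit (f : σ → (V → V) → σ) (A : Set σ) (N : ℕ) (x : σ) :
    meanHitTrunc G f A N x ≤ meanHit G f A x :=
  lintegral_mono fun _ => min_le_left _ _

theorem meanHitTrunc_succ_of_notMem [Finite σ] {f : σ → (V → V) → σ} {A : Set σ} {x : σ}
    (hx : x ∉ A) (N : ℕ) :
    meanHitTrunc G f A (N + 1) x =
      1 + ∑ c : V → V, (∏ v, neighborPMF G v (c v)) * meanHitTrunc G f A N (f x c) := by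
  have h (a : ℝ≥0∞) : min (1 + a) ((N + 1 : ℕ) : ℝ≥0∞) = 1 + min a N := by
    rw [Nat.cast_add, Nat.cast_one, add_comm (N : ℝ≥0∞), min_add_add_left]
  rw [meanHitTrunc, lintegral_choiceMeasure G ((measurable_firstTime f A x).min measurable_const)]
  simp_rw [firstTime_trajectory_consChoices hx, h, lintegral_add_left measurable_const, mul_add,
    Finset.sum_add_distrib]
  simp [sum_prod_neighborPMF, meanHitTrunc]

theorem meanHit_eq_iSup [Finite σ] (f : σ → (V → V) → σ) (A : Set σ) (x : σ) :
    meanHit G f A x = ⨆ N, meanHitTrunc G f A N x := by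
  unfold meanHit meanHitTrunc
  rw [← lintegral_iSup]
  · refine lintegral_congr fun ω => ?_
    rw [← inf_iSup_eq, ENNReal.iSup_natCast, inf_top_eq]
  · exact fun N => (measurable_firstTime f A x).min measurable_const
  · intro M N h ω
    exact min_le_min_left _ (by exact_mod_cast h)

/-! ### One-step expectations as real sums, and the drift criterion -/

variable (G)

/-- The probability that `v` selects `a`. -/
def pickProb (v a : V) : ℝ := (neighborPMF G v a).toReal

/-- The expectation of a function of the selections of one step. -/
def pickMean (g : (V → V) → ℝ) : ℝ := ∑ c : V → V, (∏ v, pickProb G v (c v)) * g c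

variable {G}

theorem pickProb_nonneg (v a : V) : 0 ≤ pickProb G v a := ENNReal.toReal_nonneg

theorem sum_pickProb (v : V) : ∑ a, pickProb G v a = 1 := by
  unfold pickProb
  rw [← ENNReal.toReal_sum fun a _ => PMF.apply_ne_top _ _, ← tsum_fintype (L := .unconditional _),
    PMF.tsum_coe, ENNReal.toReal_one]

theorem prod_pickProb_nonneg (c : V → V) : 0 ≤ ∏ v, pickProb G v (c v) :=
  Finset.prod_nonneg fun _ _ => pickProb_nonneg _ _

theorem ofReal_prod_pickProb (c : V → V) :
    ENNReal.ofReal (∏ v, pickProb G v (c v)) = ∏ v, neighborPMF G v (c v) := by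
  rw [ENNReal.ofReal_prod_of_nonneg fun _ _ => pickProb_nonneg _ _]
  exact Finset.prod_congr rfl fun v _ => ENNReal.ofReal_toReal (PMF.apply_ne_top _ _)

/-- Independence: the expectation of a product of functions of the individual selections. -/
theorem pickMean_prod (g : V → V → ℝ) :
    pickMean G (fun c => ∏ v, g v (c v)) = ∏ v, ∑ a, pickProb G v a * g v a := by
  rw [Finset.prod_univ_sum, Fintype.piFinset_univ]
  simp_rw [pickMean, Finset.prod_mul_distrib]

theorem pickMean_const (a : ℝ) : pickMean G (fun _ => a) = a := by
  have h := pickMean_prod (G := G) fun _ _ => 1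
  simp only [Finset.prod_const_one, mul_one, sum_pickProb, pickMean] at h
  rw [pickMean, ← Finset.sum_mul, h, one_mul]

theorem pickMean_mono {g h : (V → V) → ℝ} (H : ∀ c, g c ≤ h c) : pickMean G g ≤ pickMean G h :=
  Finset.sum_le_sum fun c _ => mul_le_mul_of_nonneg_left (H c) (prod_pickProb_nonneg c)

theorem pickMean_add (g h : (V → V) → ℝ) :
    pickMean G (fun c => g c + h c) = pickMean G g + pickMean G h := by
  simp [pickMean, mul_add, Finset.sum_add_distrib]

theorem pickMean_const_mul (a : ℝ) (g : (V → V) → ℝ) :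
    pickMean G (fun c => a * g c) = a * pickMean G g := by
  simp only [pickMean, Finset.mul_sum]
  exact Finset.sum_congr rfl fun c _ => by ring

theorem pickMean_sub (g h : (V → V) → ℝ) :
    pickMean G (fun c => g c - h c) = pickMean G g - pickMean G h := by
  simp [pickMean, mul_sub, Finset.sum_sub_distrib]

theorem pickMean_sum {ι : Type*} (s : Finset ι) (g : ι → (V → V) → ℝ) :
    pickMean G (fun c => ∑ i ∈ s, g i c) = ∑ i ∈ s, pickMean G (g i) := by
  simp only [pickMean, Finset.mul_sum]
  exact Finset.sum_comm

theorem pickMean_eval (u : V) (g : V → ℝ) :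
    pickMean G (fun c => g (c u)) = ∑ a, pickProb G u a * g a := by
  have h := pickMean_prod (G := G) fun v a => if v = u then g a else 1
  simp only [Finset.prod_ite_eq', Finset.mem_univ, if_true] at h
  rw [h, Finset.prod_eq_single u]
  · simp
  · intro v _ hv
    simp [hv, sum_pickProb]
  · simp

/-- A Lyapunov function bounds the mean hitting time. It is enough that on the invariant set `R`
the function decreases by one in the mean, or dominates the hitting time already. -/
theorem meanHit_le_of_drift [Finite σ] {f : σ → (V → V) → σ} {A R : Set σ} {L : σ → ℝ}
    (hR : ∀ x ∈ R, ∀ c, f x c ∈ R) (hL : ∀ x ∈ R, 0 ≤ L x)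
    (h : ∀ x ∈ R, x ∉ A → meanHit G f A x ≤ ENNReal.ofReal (L x) ∨
      1 + pickMean G (fun c => L (f x c)) ≤ L x)
    {x : σ} (hx : x ∈ R) : meanHit G f A x ≤ ENNReal.ofReal (L x) := by
  -- Truncated means satisfy the same first-step recursion and start from 0, so induction on the
  -- truncation level needs no prior finiteness of the hitting time.
  rw [meanHit_eq_iSup]
  refine iSup_le fun N => ?_
  induction N generalizing x with
  | zero => rw [meanHitTrunc_zero]; exact bot_le
  | succ N ih =>
    by_cases hA : x ∈ A
    · refine (meanHitTrunc_le_meanHit _ _ _ _).trans ?_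
      rw [meanHit_of_mem hA]
      exact bot_le
    rcases h x hx hA with h1 | h1
    · exact (meanHitTrunc_le_meanHit _ _ _ _).trans h1
    have h0 : ∀ c, 0 ≤ (∏ v, pickProb G v (c v)) * L (f x c) := fun c =>
      mul_nonneg (prod_pickProb_nonneg c) (hL _ (hR x hx c))
    rw [meanHitTrunc_succ_of_notMem hA]
    refine le_trans ?_ (ENNReal.ofReal_le_ofReal h1)
    rw [pickMean, ENNReal.ofReal_add zero_le_one (Finset.sum_nonneg fun c _ => h0 c), ENNReal.ofReal_one,
      ENNReal.ofReal_sum_of_nonneg fun c _ => h0 c]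
    refine add_le_add_right (Finset.sum_le_sum fun c _ => ?_) 1
    rw [ENNReal.ofReal_mul (prod_pickProb_nonneg c), ofReal_prod_pickProb]
    exact mul_le_mul_right (ih (hR x hx c)) _

end Bridge

/-! ### Edge counts between vertex sets -/

section Cut

variable {V : Type*} (G : SimpleGraph V) [DecidableRel G.Adj]

/-- The number of pairs of adjacent vertices with first entry in `J` and second entry in `W`. -/
def edgeCount (J W : Finset V) : ℝ := ∑ u ∈ J, ∑ w ∈ W, if G.Adj u w then 1 else 0

variable {G}

theorem edgeCount_comm (J W : Finset V) : edgeCount G J W = edgeCount G W J := by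
  unfold edgeCount
  rw [Finset.sum_comm]
  simp_rw [G.adj_comm]

theorem edgeCount_nonneg (J W : Finset V) : 0 ≤ edgeCount G J W :=
  Finset.sum_nonneg fun _ _ => Finset.sum_nonneg fun _ _ => by split_ifs <;> norm_num

theorem edgeCount_eq_sum_left (J W : Finset V) :
    edgeCount G J W = ∑ u ∈ J, edgeCount G {u} W := by
  simp [edgeCount]

theorem edgeCount_eq_sum_right (J W : Finset V) :
    edgeCount G J W = ∑ w ∈ W, edgeCount G J {w} := by
  simp only [edgeCount, Finset.sum_singleton]
  exact Finset.sum_comm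

theorem edgeCount_mono {J J' W W' : Finset V} (hJ : J ⊆ J') (hW : W ⊆ W') :
    edgeCount G J W ≤ edgeCount G J' W' := by
  have h (u w : V) : (0 : ℝ) ≤ if G.Adj u w then 1 else 0 := by split_ifs <;> norm_num
  exact (Finset.sum_le_sum fun u _ => Finset.sum_le_sum_of_subset_of_nonneg hW fun w _ _ => h u w).trans
    (Finset.sum_le_sum_of_subset_of_nonneg hJ fun u _ _ => Finset.sum_nonneg fun w _ => h u w)

theorem edgeCount_singleton_le_card (v : V) (W : Finset V) :
    edgeCount G {v} W ≤ (W.card : ℝ) := by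
  rw [edgeCount, Finset.sum_singleton]
  refine (Finset.sum_le_sum (g := fun _ => (1 : ℝ)) fun w _ => ?_).trans (by simp)
  split_ifs <;> norm_num

variable [DecidableEq V]

theorem edgeCount_union_left {J J' : Finset V} (h : Disjoint J J') (W : Finset V) :
    edgeCount G (J ∪ J') W = edgeCount G J W + edgeCount G J' W :=
  Finset.sum_union h

theorem edgeCount_union_right {W W' : Finset V} (h : Disjoint W W') (J : Finset V) :
    edgeCount G J (W ∪ W') = edgeCount G J W + edgeCount G J W' := by
  rw [edgeCount_comm, edgeCount_union_left h, edgeCount_comm, edgeCount_comm W']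

variable [Fintype V]

theorem edgeCount_singleton_univ (v : V) : edgeCount G {v} Finset.univ = G.degree v := by
  rw [edgeCount, Finset.sum_singleton, Finset.sum_boole, ← SimpleGraph.card_neighborFinset_eq_degree]
  congr 2
  ext w
  simp

theorem edgeCount_singleton_le_maxDegree (v : V) (W : Finset V) :
    edgeCount G {v} W ≤ G.maxDegree := by
  refine (edgeCount_mono subset_rfl (Finset.subset_univ W)).trans ?_
  rw [edgeCount_singleton_univ]
  exact_mod_cast G.degree_le_maxDegree v

theorem degree_pos_of_connected [Nontrivial V] (hG : G.Connected) (v : V) : 0 < G.degree v :=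
  hG.preconnected.degree_pos_of_nontrivial v

theorem minDegree_pos_of_connected [Nontrivial V] (hG : G.Connected) : 0 < G.minDegree :=
  hG.preconnected.minDegree_pos_of_nontrivial

theorem one_le_edgeCount_compl (hG : G.Connected) {S : Finset V} (h1 : S.Nonempty)
    (h2 : S ≠ Finset.univ) : 1 ≤ edgeCount G S Sᶜ := by
  obtain ⟨u, hu⟩ := h1
  obtain ⟨w, hw⟩ : ∃ w, w ∉ S := by simpa [Finset.eq_univ_iff_forall] using h2
  obtain ⟨p⟩ := hG.preconnected u w
  obtain ⟨d, -, hd1, hd2⟩ := p.exists_boundary_dart (S : Set V) (by simpa using hu) (by simpa using hw)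
  have : edgeCount G {d.fst} {d.snd} ≤ edgeCount G S Sᶜ :=
    edgeCount_mono (by simpa using hd1) (by simpa using hd2)
  rwa [edgeCount, Finset.sum_singleton, Finset.sum_singleton, if_pos d.adj] at this

theorem pickProb_eq (v a : V) (hv : 0 < G.degree v) :
    pickProb G v a = (if G.Adj v a then 1 else 0) / G.degree v := by
  have hne : (G.neighborFinset v).Nonempty := by
    rwa [← Finset.card_pos, SimpleGraph.card_neighborFinset_eq_degree]
  rw [pickProb, neighborPMF, dif_pos hne, PMF.uniformOfFinset_apply]
  simp only [SimpleGraph.mem_neighborFinset, SimpleGraph.card_neighborFinset_eq_degree]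
  split_ifs <;> simp

end Cut

/-! ### Large cuts from the blanket time -/

section LowerBound

variable {V : Type*} [Fintype V] [DecidableEq V] {G : SimpleGraph V} [DecidableRel G.Adj]

theorem toReal_meanHit_of_notMem {σ : Type*} [Finite σ] {f : σ → (V → V) → σ} {A : Set σ}
    (hfin : ∀ y, meanHit G f A y ≠ ⊤) {x : σ} (hx : x ∉ A) :
    (meanHit G f A x).toReal = 1 + pickMean G fun c => (meanHit G f A (f x c)).toReal := by
  have hp (c : V → V) : (∏ v, neighborPMF G v (c v)) * meanHit G f A (f x c) ≠ ⊤ :=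
    ENNReal.mul_ne_top (ENNReal.prod_ne_top fun _ _ => PMF.apply_ne_top _ _) (hfin _)
  rw [meanHit_of_notMem hx, ENNReal.toReal_add ENNReal.one_ne_top
    (ENNReal.sum_ne_top.2 fun c _ => hp c), ENNReal.toReal_sum fun c _ => hp c, ENNReal.toReal_one]
  simp only [pickMean, ENNReal.toReal_mul, ENNReal.toReal_prod, pickProb]

theorem trajectory_eq_walk (s : V) (ω : Choices V) (t : ℕ) :
    trajectory (fun v c => c v) s ω t = walk s ω t := by
  induction t with
  | zero => rfl
  | succ t ih => rw [trajectory, ih, walk]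

theorem stationary_pos [Nontrivial V] (hG : G.Connected) (u : V) : 0 < stationary G u := by
  have h := degree_pos_of_connected hG u
  have h1 : 0 < G.edgeFinset.card := by
    obtain ⟨w, hw⟩ := (G.degree_pos_iff_exists_adj u).1 h
    exact Finset.card_pos.2 ⟨s(u, w), by simpa using hw⟩
  unfold stationary
  positivity

/-- A blanket walk has visited every vertex. -/
theorem exists_walk_eq_of_isBlanket [Nontrivial V] (hG : G.Connected) {s : V} {ω : Choices V} {t : ℕ}
    (h : IsBlanket G s ω t) (u : V) : ∃ t' ≤ t, walk s ω t' = u := by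
  -- Time 0 is never blanket: the start already counts as one visit, while the upper bound would be
  -- 0.
  have ht : t ≠ 0 := by
    rintro rfl
    have := (h s).2
    simp [visits, walk] at this
  have hpos : 0 < visits s ω t u := by
    have h1 := (h u).1
    have h2 := stationary_pos hG u
    have h3 : (0 : ℝ) < t := by exact_mod_cast Nat.pos_of_ne_zero ht
    have : (0 : ℝ) < visits s ω t u := lt_of_lt_of_le (by positivity) h1
    exact_mod_cast this
  obtain ⟨t', ht'⟩ := Finset.card_pos.1 hpos
  simp only [Finset.mem_filter, Finset.mem_range] at ht'
  exact ⟨t', by omega, ht'.2⟩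

/-- By the blanket time some vertex outside `S` has been visited, so the walk has already left `S`.
-/
theorem meanHit_compl_le_blanketTime [Nontrivial V] (hG : G.Connected) {S : Finset V}
    (hS : S ≠ Finset.univ) (s : V) :
    meanHit G (fun v c => c v) ((S : Set V)ᶜ) s ≤ blanketTime G := by
  obtain ⟨w, hw⟩ : ∃ w, w ∉ S := by simpa [Finset.eq_univ_iff_forall] using hS
  refine le_trans (lintegral_mono fun ω => firstTime_le_firstTime fun t ht => ?_)
    (le_iSup (fun s : V => ∫⁻ ω, firstTime (IsBlanket G s ω) ∂choiceMeasure G) s)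
  obtain ⟨t', h1, h2⟩ := exists_walk_eq_of_isBlanket hG ht w
  exact ⟨t', h1, by rw [trajectory_eq_walk, h2]; simpa using hw⟩

/-- The blanket time dominates the mean time to leave `S`, which is at least the volume of `S`
divided by the size of its edge boundary. -/
theorem sum_degree_le_blanketTime_mul [Nontrivial V] (hG : G.Connected) {S : Finset V}
    (hS : S ≠ Finset.univ) (hb : blanketTime G ≠ ⊤) :
    ∑ v ∈ S, (G.degree v : ℝ) ≤ (blanketTime G).toReal * edgeCount G S Sᶜ := by
  have hle := meanHit_compl_le_blanketTime hG hS
  set h : V → ℝ := fun v => (meanHit G (fun v c => c v) ((S : Set V)ᶜ) v).toReal with hh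
  have hfin (v : V) : meanHit G (fun v c => c v) ((S : Set V)ᶜ) v ≠ ⊤ := ne_top_of_le_ne_top hb (hle v)
  have hb' (v : V) : h v ≤ (blanketTime G).toReal := ENNReal.toReal_mono hb (hle v)
  have h0 (v : V) (hv : v ∉ S) : h v = 0 := by
    simp only [hh]
    rw [meanHit_of_mem (by simpa using hv), ENNReal.toReal_zero]
  let a : V → V → ℝ := fun u w => if G.Adj u w then 1 else 0
  have ha (u w : V) : a u w = a w u := by simp [a, G.adj_comm]
  have hdeg (v : V) : (G.degree v : ℝ) = ∑ w ∈ S, a v w + ∑ w ∈ Sᶜ, a v w := by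
    rw [Finset.sum_add_sum_compl, ← edgeCount_singleton_univ, edgeCount, Finset.sum_singleton]
  -- The Poisson equation for the exit time, multiplied by the degree; neighbours outside `S`
  -- contribute 0.
  have hstep (v : V) (hv : v ∈ S) : G.degree v * h v = G.degree v + ∑ w ∈ S, a v w * h w := by
    have hd : (G.degree v : ℝ) ≠ 0 := by exact_mod_cast (degree_pos_of_connected hG v).ne'
    have h1 : h v = 1 + ∑ w, pickProb G v w * h w := by
      rw [← pickMean_eval v h]
      exact toReal_meanHit_of_notMem hfin (by simpa using hv)
    have h2 : ∑ w, pickProb G v w * h w = (∑ w ∈ S, a v w * h w) / G.degree v := by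
      rw [Finset.sum_div, ← Finset.sum_subset (Finset.subset_univ S)]
      · refine Finset.sum_congr rfl fun w _ => ?_
        rw [pickProb_eq v w (degree_pos_of_connected hG v)]
        ring
      · intro w _ hw
        rw [h0 w hw, mul_zero]
    rw [h1, h2]
    field_simp
  have hsum : ∑ v ∈ S, G.degree v * h v =
      ∑ v ∈ S, (G.degree v : ℝ) + ∑ v ∈ S, ∑ w ∈ S, a v w * h v := by
    rw [Finset.sum_congr rfl hstep, Finset.sum_add_distrib, Finset.sum_comm (γ := V)]
    simp_rw [ha]
  have hsum' : ∑ v ∈ S, G.degree v * h v =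
      ∑ v ∈ S, ∑ w ∈ S, a v w * h v + ∑ v ∈ S, ∑ w ∈ Sᶜ, a v w * h v := by
    simp_rw [hdeg, add_mul, Finset.sum_mul, Finset.sum_add_distrib]
  -- By symmetry of adjacency the terms interior to `S` cancel. Only boundary edges remain, and each
  -- weight `h v` is at most the blanket time.
  have hkey : ∑ v ∈ S, (G.degree v : ℝ) = ∑ v ∈ S, ∑ w ∈ Sᶜ, a v w * h v := by linarith
  rw [hkey, edgeCount, Finset.mul_sum]
  refine Finset.sum_le_sum fun v _ => ?_
  rw [Finset.mul_sum]
  refine Finset.sum_le_sum fun w _ => ?_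
  rw [mul_comm]
  refine mul_le_mul_of_nonneg_right (hb' v) ?_
  simp only [a]
  split_ifs <;> norm_num

/-- `S` and its complement share one edge boundary, and their volumes add up to the total degree,
which is at least nδ. -/
theorem card_mul_minDegree_le_blanketTime_mul [Nontrivial V] (hG : G.Connected) {S : Finset V}
    (hS : S.Nonempty) (hS' : S ≠ Finset.univ) (hb : blanketTime G ≠ ⊤) :
    (Fintype.card V : ℝ) * G.minDegree ≤ 2 * (blanketTime G).toReal * edgeCount G S Sᶜ := by
  have h1 := sum_degree_le_blanketTime_mul hG hS' hb
  have h2 := sum_degree_le_blanketTime_mul hG (S := Sᶜ)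
    (by simpa [Finset.compl_eq_univ_iff] using hS.ne_empty) hb
  rw [compl_compl, edgeCount_comm] at h2
  have h3 : ∑ v ∈ S, (G.degree v : ℝ) + ∑ v ∈ Sᶜ, (G.degree v : ℝ) = ∑ v, (G.degree v : ℝ) :=
    Finset.sum_add_sum_compl _ _
  have h4 : (Fintype.card V : ℝ) * G.minDegree ≤ ∑ v, (G.degree v : ℝ) := by
    rw [← nsmul_eq_mul, ← Finset.card_univ, ← Finset.sum_const]
    exact Finset.sum_le_sum fun v _ => by exact_mod_cast G.minDegree_le_degree v
  linarith

end LowerBound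

/-! ### The three mechanisms of spreading: saturation, crossing, growth -/

section Stages

variable {V : Type*} [Fintype V] [DecidableEq V] {G : SimpleGraph V} [DecidableRel G.Adj]

/-- The probability that no vertex of `J` selects a vertex of `W`. -/
theorem pickMean_miss_le [Nontrivial V] (hG : G.Connected) (J W : Finset V) :
    pickMean G (fun c => if ∀ u ∈ J, c u ∉ W then 1 else 0) ≤
      1 / (1 + edgeCount G J W / G.maxDegree) := by
  have hΔ (v : V) : (G.degree v : ℝ) ≤ G.maxDegree := by exact_mod_cast G.degree_le_maxDegree v
  have hd (v : V) : (0 : ℝ) < G.degree v := by exact_mod_cast degree_pos_of_connected hG v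
  have hprod : pickMean G (fun c => if ∀ u ∈ J, c u ∉ W then 1 else 0) =
      ∏ v, ∑ a, pickProb G v a * (if v ∈ J → a ∉ W then 1 else 0) := by
    rw [← pickMean_prod]
    congr 1
    ext c
    rw [Finset.prod_ite_zero]
    simp
  -- Each factor is 1 - e(v,W)/deg v ≤ exp(-e(v,W)/Δ). The product is exp(-e(J,W)/Δ), and exp x ≥ 1
  -- + x gives the rational bound.
  have hfactor (v : V) : ∑ a, pickProb G v a * (if v ∈ J → a ∉ W then 1 else 0) ≤
      Real.exp (-(if v ∈ J then edgeCount G {v} W / G.maxDegree else 0)) := by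
    by_cases hv : v ∈ J
    · simp only [hv, true_imp_iff, if_true]
      have h1 : ∑ a, pickProb G v a * (if a ∉ W then 1 else 0) =
          1 - edgeCount G {v} W / G.degree v := by
        have e1 : ∑ a ∈ W, pickProb G v a * (if a ∉ W then (1 : ℝ) else 0) = 0 :=
          Finset.sum_eq_zero fun a ha => by simp [ha]
        have e2 : ∑ a ∈ Wᶜ, pickProb G v a * (if a ∉ W then (1 : ℝ) else 0) =
            ∑ a ∈ Wᶜ, pickProb G v a :=
          Finset.sum_congr rfl fun a ha => by rw [if_pos (Finset.mem_compl.1 ha), mul_one]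
        have e3 : ∑ a ∈ W, pickProb G v a = ∑ a ∈ W, (if G.Adj v a then 1 else 0) / (G.degree v : ℝ) :=
          Finset.sum_congr rfl fun a _ => pickProb_eq v a (degree_pos_of_connected hG v)
        have e4 := sum_pickProb (G := G) v
        rw [← Finset.sum_add_sum_compl W] at e4
        rw [← Finset.sum_add_sum_compl W, e1, e2, edgeCount, Finset.sum_singleton, Finset.sum_div,
          ← e3]
        linarith
      rw [h1]
      have h2 : edgeCount G {v} W / G.maxDegree ≤ edgeCount G {v} W / G.degree v :=
        div_le_div_of_nonneg_left (edgeCount_nonneg _ _) (hd v) (hΔ v)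
      have h3 := Real.add_one_le_exp (-(edgeCount G {v} W / G.maxDegree))
      linarith
    · simp [hv, sum_pickProb]
  rw [hprod]
  have hnn (v : V) : 0 ≤ ∑ a, pickProb G v a * (if v ∈ J → a ∉ W then 1 else 0) :=
    Finset.sum_nonneg fun a _ => mul_nonneg (pickProb_nonneg _ _) (by split_ifs <;> norm_num)
  refine (Finset.prod_le_prod (fun v _ => hnn v) fun v _ => hfactor v).trans ?_
  rw [← Real.exp_sum, Finset.sum_neg_distrib, Finset.sum_ite_mem, Finset.univ_inter,
    ← Finset.sum_div, ← edgeCount_eq_sum_left, Real.exp_neg, one_div]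
  have h0 : 0 ≤ edgeCount G J W / G.maxDegree := div_nonneg (edgeCount_nonneg _ _) (by positivity)
  refine inv_anti₀ (by positivity) ?_
  linarith [Real.add_one_le_exp (edgeCount G J W / G.maxDegree)]

/-- For a single target the ratio x = e(J,w)/Δ is at most 1, where 1/(1+x) ≤ 1 - x/2. The linear
form can be summed over targets. -/
theorem pickMean_miss_singleton_le [Nontrivial V] (hG : G.Connected) (J : Finset V) (w : V) :
    pickMean G (fun c => if ∀ u ∈ J, c u ∉ ({w} : Finset V) then 1 else 0) ≤
      1 - edgeCount G J {w} / (2 * G.maxDegree) := by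
  refine (pickMean_miss_le hG J {w}).trans ?_
  have hΔ : (0 : ℝ) < G.maxDegree := by
    exact_mod_cast (degree_pos_of_connected hG w).trans_le (G.degree_le_maxDegree w)
  have h1 : edgeCount G J {w} / G.maxDegree ≤ 1 := by
    rw [div_le_one hΔ, edgeCount_comm]
    exact edgeCount_singleton_le_maxDegree w J
  have h0 : 0 ≤ edgeCount G J {w} / G.maxDegree := div_nonneg (edgeCount_nonneg _ _) hΔ.le
  have h2 : edgeCount G J {w} / (2 * G.maxDegree) = edgeCount G J {w} / G.maxDegree / 2 := by
    field_simp
  rw [h2, div_le_iff₀ (by positivity)]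
  nlinarith

/-- One step of the push algorithm. -/
def pushStep (J : Finset V) (c : V → V) : Finset V := J ∪ J.image c

theorem trajectory_eq_informed (s : V) (ω : Choices V) (t : ℕ) :
    trajectory pushStep {s} ω t = informed s ω t := by
  induction t with
  | zero => rfl
  | succ t ih => rw [trajectory, ih, informed, pushStep]

theorem subset_pushStep (J : Finset V) (c : V → V) : J ⊆ pushStep J c := Finset.subset_union_left

variable (G)

/-- The mean time until all vertices are informed, if the vertices in `J` are informed initially. -/
def spreadTime (J : Finset V) : ℝ≥0∞ := meanHit G pushStep {Finset.univ} J

variable {G}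

theorem expectedBroadcastTime_eq : expectedBroadcastTime G = ⨆ s : V, spreadTime G {s} := by
  unfold expectedBroadcastTime spreadTime meanHit
  simp_rw [trajectory_eq_informed, Set.mem_singleton_iff]

theorem card_sdiff_pushStep (W J : Finset V) (c : V → V) :
    ((W \ pushStep J c).card : ℝ) =
      ∑ w ∈ W \ J, if ∀ u ∈ J, c u ∉ ({w} : Finset V) then 1 else 0 := by
  rw [Finset.sum_boole]
  congr 2
  ext w
  simp only [pushStep, Finset.mem_sdiff, Finset.mem_union, Finset.mem_image, Finset.mem_filter,
    Finset.mem_singleton]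
  push Not
  tauto

variable [Nontrivial V] {K : ℝ}

/-- If every vertex of `W` has many neighbours in `I`, then half of `W` is informed soon. -/
theorem spreadTime_le_of_half_informed (hG : G.Connected)
    (hΔ : (G.maxDegree : ℝ) ≤ K * G.minDegree) (hK : 1 ≤ K) {I W : Finset V} {M : ℝ} (hM : 0 ≤ M)
    (hW : ∀ w ∈ W, (G.minDegree : ℝ) / 2 ≤ edgeCount G I {w})
    (h : ∀ J, I ⊆ J → 2 * ((W \ J).card : ℝ) ≤ W.card → spreadTime G J ≤ ENNReal.ofReal M) :
    spreadTime G I ≤ ENNReal.ofReal (8 * K + M) := by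
  have hδ : (0 : ℝ) < G.minDegree := by exact_mod_cast minDegree_pos_of_connected hG
  have hΔ0 : (0 : ℝ) < G.maxDegree := lt_of_lt_of_le hδ (by exact_mod_cast G.minDegree_le_maxDegree)
  -- Each missing vertex is informed with probability at least 1/(4K). While more than half of `W`
  -- is missing, the mean drop is at least (8K/|W|)(|W|/2)/(4K) = 1.
  let L : Finset V → ℝ := fun J => 8 * K / W.card * (W \ J).card + M
  have hL (J : Finset V) : M ≤ L J := by
    have : 0 ≤ 8 * K / (W.card : ℝ) * (W \ J).card := by positivity
    simp only [L]
    linarith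
  have key : spreadTime G I ≤ ENNReal.ofReal (L I) := by
    refine meanHit_le_of_drift (R := {J | I ⊆ J}) (fun J hJ c => hJ.trans (subset_pushStep J c))
      (fun J _ => hM.trans (hL J)) (fun J hJ _ => ?_) (subset_refl I)
    by_cases hhalf : 2 * ((W \ J).card : ℝ) ≤ W.card
    · exact Or.inl ((h J hJ hhalf).trans (ENNReal.ofReal_le_ofReal (hL J)))
    right
    push Not at hhalf
    have hWpos : (0 : ℝ) < W.card := by
      have : ((W \ J).card : ℝ) ≤ W.card := by
        exact_mod_cast Finset.card_le_card Finset.sdiff_subset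
      linarith
    have hmean : pickMean G (fun c => ((W \ pushStep J c).card : ℝ)) ≤
        (W \ J).card * (1 - 1 / (4 * K)) := by
      simp_rw [card_sdiff_pushStep]
      rw [pickMean_sum, ← nsmul_eq_mul, ← Finset.sum_const]
      refine Finset.sum_le_sum fun w hw => (pickMean_miss_singleton_le hG J w).trans ?_
      have h1 := (hW w (Finset.mem_sdiff.1 hw).1).trans (edgeCount_mono hJ subset_rfl)
      have : 1 / (4 * K) ≤ edgeCount G J {w} / (2 * G.maxDegree) := by
        rw [div_le_div_iff₀ (by positivity) (by positivity)]
        nlinarith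
      linarith
    simp only [L]
    rw [pickMean_add, pickMean_const_mul, pickMean_const]
    have h2 : 8 * K / W.card * pickMean G (fun c => ((W \ pushStep J c).card : ℝ)) ≤
        8 * K / W.card * ((W \ J).card * (1 - 1 / (4 * K))) :=
      mul_le_mul_of_nonneg_left hmean (by positivity)
    have h3 : 8 * K / W.card * ((W \ J).card * (1 - 1 / (4 * K))) =
        8 * K / W.card * (W \ J).card - 2 * (W \ J).card / W.card := by
      field_simp
      ring
    have h4 : 1 ≤ 2 * ((W \ J).card : ℝ) / W.card := by
      rw [le_div_iff₀ hWpos]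
      linarith
    linarith
  refine key.trans (ENNReal.ofReal_le_ofReal ?_)
  have h5 : ((W \ I).card : ℝ) / W.card ≤ 1 :=
    div_le_one_of_le₀ (by exact_mod_cast Finset.card_le_card Finset.sdiff_subset) (by positivity)
  have h6 : L I = 8 * K * (((W \ I).card : ℝ) / W.card) + M := by
    simp only [L]
    ring
  rw [h6]
  nlinarith

/-- The time until some edge from `I` to `U` is used. -/
theorem spreadTime_le_of_crossing (hG : G.Connected) {I U : Finset V} {M : ℝ} (hM : 0 ≤ M)
    (hU : 0 < edgeCount G I U)
    (h : ∀ J, I ⊆ J → (J ∩ U).Nonempty → spreadTime G J ≤ ENNReal.ofReal M) :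
    spreadTime G I ≤ ENNReal.ofReal (1 + G.maxDegree / edgeCount G I U + M) := by
  have hδ : (0 : ℝ) < G.minDegree := by exact_mod_cast minDegree_pos_of_connected hG
  have hΔ0 : (0 : ℝ) < G.maxDegree := lt_of_lt_of_le hδ (by exact_mod_cast G.minDegree_le_maxDegree)
  set y := edgeCount G I U
  set D : ℝ := 1 + G.maxDegree / y with hD
  have hDpos : 0 ≤ D := by positivity
  -- `D` is the mean of a geometric time with failure probability 1/(1 + y/Δ), so `D` times that
  -- probability equals `D - 1`.
  let L : Finset V → ℝ := fun J => if (J ∩ U).Nonempty then M else D + M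
  have hL (J : Finset V) : M ≤ L J := by
    simp only [L]
    split_ifs <;> linarith
  have key : spreadTime G I ≤ ENNReal.ofReal (L I) := by
    refine meanHit_le_of_drift (R := {J | I ⊆ J}) (fun J hJ c => hJ.trans (subset_pushStep J c))
      (fun J _ => hM.trans (hL J)) (fun J hJ _ => ?_) (subset_refl I)
    by_cases hne : (J ∩ U).Nonempty
    · exact Or.inl ((h J hJ hne).trans (ENNReal.ofReal_le_ofReal (hL J)))
    right
    have h1 : pickMean G (fun c => L (pushStep J c)) ≤
        pickMean G fun c => D * (if ∀ u ∈ J, c u ∉ U then 1 else 0) + M := by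
      refine pickMean_mono fun c => ?_
      by_cases hc : ∀ u ∈ J, c u ∉ U
      · simp only [L, if_pos hc]
        split_ifs <;> linarith
      · rw [if_neg hc]
        push Not at hc
        obtain ⟨u, hu, hcu⟩ := hc
        have : (pushStep J c ∩ U).Nonempty :=
          ⟨c u, Finset.mem_inter.2 ⟨Finset.mem_union_right _ (Finset.mem_image_of_mem c hu), hcu⟩⟩
        simp only [L, if_pos this]
        linarith
    rw [pickMean_add, pickMean_const_mul, pickMean_const] at h1
    have h2 : y / G.maxDegree ≤ edgeCount G J U / G.maxDegree :=
      div_le_div_of_nonneg_right (edgeCount_mono hJ subset_rfl) hΔ0.le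
    have h3 : pickMean G (fun c => if ∀ u ∈ J, c u ∉ U then 1 else 0) ≤ 1 / (1 + y / G.maxDegree) :=
      (pickMean_miss_le hG J U).trans (one_div_le_one_div_of_le (by positivity) (by linarith))
    have h4 : D * (1 / (1 + y / G.maxDegree)) = G.maxDegree / y := by
      rw [hD]
      field_simp
      ring
    have h5 := mul_le_mul_of_nonneg_left h3 hDpos
    have h6 : L J = D + M := by simp only [L, if_neg hne]
    rw [h6]
    linarith
  refine key.trans (ENNReal.ofReal_le_ofReal ?_)
  simp only [L]
  split_ifs <;> linarith

/-- With r = y/x ≤ 1, log(1+r) ≥ 1 - 1/(1+r) ≥ r/2. This turns a relative gain in the mean into an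
additive drift of a logarithmic potential. -/
theorem log_add_le_log_add {x y : ℝ} (hx : 0 < x) (hy : 0 ≤ y) (hyx : y ≤ x) :
    Real.log x + y / (2 * x) ≤ Real.log (x + y) := by
  have h1 : x + y = x * (1 + y / x) := by field_simp
  have h0 : 0 ≤ y / x := by positivity
  have h2 : y / x ≤ 1 := (div_le_one hx).2 hyx
  rw [h1, Real.log_mul hx.ne' (by positivity)]
  have h3 := Real.one_sub_inv_le_log_of_pos (show 0 < 1 + y / x by positivity)
  have h4 : y / (2 * x) = y / x / 2 := by field_simp
  have h5 : y / x / 2 ≤ 1 - (1 + y / x)⁻¹ := by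
    rw [le_sub_iff_add_le, ← le_sub_iff_add_le', inv_le_iff_one_le_mul₀ (by positivity)]
    nlinarith
  rw [h4]
  linarith

/-- Inside a set `U` of large minimum degree, the number of informed vertices grows exponentially
until it is a constant fraction of the minimum degree. -/
theorem spreadTime_le_of_growth (hG : G.Connected)
    (hΔ : (G.maxDegree : ℝ) ≤ K * G.minDegree) (hK : 1 ≤ K) {I U : Finset V} {M : ℝ} (hM : 0 ≤ M)
    (hU : ∀ w ∈ U, (G.minDegree : ℝ) / 16 ≤ edgeCount G {w} U)
    (h : ∀ J, I ⊆ J → (G.minDegree : ℝ) / 32 ≤ (J ∩ U).card → spreadTime G J ≤ ENNReal.ofReal M)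
    {J : Finset V} (hIJ : I ⊆ J) (hJU : (J ∩ U).Nonempty) :
    spreadTime G J ≤ ENNReal.ofReal (128 * K * Real.log (Fintype.card V) + M) := by
  have hδ : (0 : ℝ) < G.minDegree := by exact_mod_cast minDegree_pos_of_connected hG
  have hΔ0 : (0 : ℝ) < G.maxDegree := lt_of_lt_of_le hδ (by exact_mod_cast G.minDegree_le_maxDegree)
  -- With x informed vertices in `U`, the mean gain is at least x/(64K), so the logarithm grows by
  -- at least 1/(128K) in the mean; the factor 128K makes this a unit drift.
  let L : Finset V → ℝ := fun J =>
    128 * K * (Real.log (Fintype.card V) - Real.log ((J ∩ U).card : ℝ)) + M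
  have hL (J : Finset V) (hJ : (J ∩ U).Nonempty) : M ≤ L J := by
    have h1 : Real.log ((J ∩ U).card : ℝ) ≤ Real.log (Fintype.card V) :=
      Real.log_le_log (by exact_mod_cast hJ.card_pos) (by exact_mod_cast Finset.card_le_univ _)
    have : 0 ≤ 128 * K * (Real.log (Fintype.card V) - Real.log ((J ∩ U).card : ℝ)) :=
      mul_nonneg (by positivity) (by linarith)
    simp only [L]
    linarith
  have key : spreadTime G J ≤ ENNReal.ofReal (L J) := by
    refine meanHit_le_of_drift (R := {J | I ⊆ J ∧ (J ∩ U).Nonempty})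
      (fun J hJ c => ⟨hJ.1.trans (subset_pushStep J c),
        hJ.2.mono (Finset.inter_subset_inter_right (subset_pushStep J c))⟩)
      (fun J hJ => hM.trans (hL J hJ.2)) (fun J hJ _ => ?_) ⟨hIJ, hJU⟩
    by_cases hbig : (G.minDegree : ℝ) / 32 ≤ (J ∩ U).card
    · exact Or.inl ((h J hJ.1 hbig).trans (ENNReal.ofReal_le_ofReal (hL J hJ.2)))
    right
    push Not at hbig
    set x : ℝ := ((J ∩ U).card : ℝ) with hx
    have hxpos : 0 < x := by rw [hx]; exact_mod_cast hJ.2.card_pos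
    -- Only selections made by `J ∩ U` are counted. This keeps the gain at most x, as the
    -- logarithmic inequality requires.
    let Y : (V → V) → ℝ := fun c =>
      ∑ w ∈ U \ J, (1 - if ∀ u ∈ J ∩ U, c u ∉ ({w} : Finset V) then 1 else 0)
    have hYcard (c : V → V) :
        Y c = ((U \ J).filter fun w => ∃ u ∈ J ∩ U, c u = w).card := by
      rw [← Finset.sum_boole]
      refine Finset.sum_congr rfl fun w _ => ?_
      by_cases hc : ∃ u ∈ J ∩ U, c u = w
      · rw [if_pos hc, if_neg (by push Not; simpa using hc)]
        norm_num
      · rw [if_neg hc, if_pos (by push Not at hc; simpa using hc)]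
        norm_num
    have hY0 (c : V → V) : 0 ≤ Y c := by rw [hYcard]; positivity
    have hYx (c : V → V) : Y c ≤ x := by
      rw [hYcard, hx]
      norm_cast
      refine le_trans (Finset.card_le_card (t := (J ∩ U).image c) fun w hw => ?_)
        Finset.card_image_le
      simpa using (Finset.mem_filter.1 hw).2
    have hgrow (c : V → V) : x + Y c ≤ ((pushStep J c ∩ U).card : ℝ) := by
      rw [hYcard, hx]
      norm_cast
      rw [← Finset.card_union_of_disjoint]
      · refine Finset.card_le_card fun w hw => ?_
        simp only [Finset.mem_union, Finset.mem_inter, Finset.mem_filter, Finset.mem_sdiff] at hw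
        simp only [pushStep, Finset.mem_inter, Finset.mem_union, Finset.mem_image]
        rcases hw with hw | ⟨hw, u, hu, huw⟩
        · exact ⟨Or.inl hw.1, hw.2⟩
        · exact ⟨Or.inr ⟨u, hu.1, huw⟩, hw.1⟩
      · rw [Finset.disjoint_left]
        intro w hw hw'
        exact (Finset.mem_sdiff.1 (Finset.mem_filter.1 hw').1).2 (Finset.mem_inter.1 hw).1
    have hmean : x / (64 * K) ≤ pickMean G Y := by
      have h1 : edgeCount G (J ∩ U) (U \ J) / (2 * G.maxDegree) ≤ pickMean G Y := by
        simp only [Y]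
        rw [pickMean_sum, edgeCount_eq_sum_right, Finset.sum_div]
        refine Finset.sum_le_sum fun w _ => ?_
        rw [pickMean_sub, pickMean_const]
        linarith [pickMean_miss_singleton_le hG (J ∩ U) w]
      -- Of the at least δ/16 neighbours in `U`, fewer than δ/32 are informed already.
      have h2 : x * (G.minDegree / 32) ≤ edgeCount G (J ∩ U) (U \ J) := by
        rw [edgeCount_eq_sum_left, hx, ← nsmul_eq_mul, ← Finset.sum_const]
        refine Finset.sum_le_sum fun u hu => ?_
        have h3 := hU u (Finset.mem_inter.1 hu).2
        have h4 : edgeCount G {u} U = edgeCount G {u} (U \ J) + edgeCount G {u} (J ∩ U) := by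
          rw [← edgeCount_union_right, Finset.inter_comm, Finset.sdiff_union_inter]
          rw [Finset.inter_comm]
          exact Finset.disjoint_sdiff_inter U J
        have h5 := edgeCount_singleton_le_card (G := G) u (J ∩ U)
        linarith
      refine le_trans ?_ h1
      rw [div_le_div_iff₀ (by positivity) (by positivity)]
      nlinarith
    have hdrop (c : V → V) : L (pushStep J c) ≤ L J - 64 * K / x * Y c := by
      have h1 := log_add_le_log_add hxpos (hY0 c) (hYx c)
      have h2 := Real.log_le_log (by linarith [hY0 c]) (hgrow c)
      have h3 : 64 * K / x * Y c = 128 * K * (Y c / (2 * x)) := by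
        field_simp
        ring
      have h4 : 128 * K * (Real.log x + Y c / (2 * x)) ≤
          128 * K * Real.log ((pushStep J c ∩ U).card : ℝ) :=
        mul_le_mul_of_nonneg_left (h1.trans h2) (by positivity)
      rw [h3]
      simp only [L, ← hx]
      linarith
    have hfinal := pickMean_mono (G := G) hdrop
    rw [pickMean_sub, pickMean_const, pickMean_const_mul] at hfinal
    have h6 : 64 * K / x * (x / (64 * K)) = 1 := by field_simp
    have h7 := mul_le_mul_of_nonneg_left hmean (show 0 ≤ 64 * K / x by positivity)
    linarith
  refine key.trans (ENNReal.ofReal_le_ofReal ?_)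
  have h1 : 0 ≤ Real.log ((J ∩ U).card : ℝ) := Real.log_natCast_nonneg _
  have : 0 ≤ 128 * K * Real.log ((J ∩ U).card : ℝ) := by positivity
  simp only [L]
  linarith

end Stages

/-! ### Combining the mechanisms into phases and summing them -/

section Total

variable {V : Type*} [Fintype V] [DecidableEq V] {G : SimpleGraph V} [DecidableRel G.Adj]

theorem spreadTime_univ : spreadTime G Finset.univ = 0 := meanHit_of_mem rfl

/-- Informing vertices that have few neighbours outside `I` shrinks the edge boundary. -/
theorem edgeCount_compl_le_of_bad {I J B : Finset V} (hIJ : I ⊆ J) (hJ : J ⊆ I ∪ B)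
    (hBI : Disjoint B I) (hB : ∀ w ∈ B, edgeCount G {w} Iᶜ < (G.minDegree : ℝ) / 8) :
    edgeCount G J Jᶜ ≤ edgeCount G I Iᶜ - 3 / 4 * G.minDegree * (J ∩ B).card := by
  have hJe : J = I ∪ (J ∩ B) := by
    ext w
    have h1 := @hIJ w
    have h2 := @hJ w
    simp only [Finset.mem_union, Finset.mem_inter] at h2 ⊢
    tauto
  have hIc : Iᶜ = (J ∩ B) ∪ Jᶜ := by
    ext w
    have h1 := @hIJ w
    have h2 := @hJ w
    have h3 : w ∈ B → w ∉ I := fun h => Finset.disjoint_left.1 hBI h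
    simp only [Finset.mem_union, Finset.mem_inter, Finset.mem_compl] at h2 ⊢
    tauto
  have hd1 : Disjoint I (J ∩ B) := (hBI.mono_left Finset.inter_subset_right).symm
  have hd2 : Disjoint (J ∩ B) Jᶜ :=
    disjoint_compl_right.mono_left Finset.inter_subset_left
  have h1 : edgeCount G J Jᶜ = edgeCount G I Jᶜ + edgeCount G (J ∩ B) Jᶜ := by
    conv_lhs => rw [hJe, edgeCount_union_left hd1, ← hJe]
  have h2 : edgeCount G I Iᶜ = edgeCount G I (J ∩ B) + edgeCount G I Jᶜ := by
    rw [hIc, edgeCount_union_right hd2]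
  -- Each new vertex adds at most δ/8 boundary edges and removes at least 7δ/8, its edges into `I`;
  -- the net loss is 3δ/4.
  have h3 : edgeCount G (J ∩ B) Jᶜ ≤ (J ∩ B).card * (G.minDegree / 8 : ℝ) := by
    rw [edgeCount_eq_sum_left, ← nsmul_eq_mul, ← Finset.sum_const]
    refine Finset.sum_le_sum fun w hw => ?_
    exact (edgeCount_mono subset_rfl (Finset.compl_subset_compl.2 hIJ)).trans
      (hB w (Finset.mem_inter.1 hw).2).le
  have h4 : (J ∩ B).card * (7 / 8 * G.minDegree : ℝ) ≤ edgeCount G I (J ∩ B) := by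
    rw [edgeCount_comm, edgeCount_eq_sum_left, ← nsmul_eq_mul, ← Finset.sum_const]
    refine Finset.sum_le_sum fun w hw => ?_
    have h5 : edgeCount G {w} I + edgeCount G {w} Iᶜ = G.degree w := by
      rw [← edgeCount_union_right disjoint_compl_right, Finset.union_compl,
        edgeCount_singleton_univ]
    have h6 : (G.minDegree : ℝ) ≤ G.degree w := by exact_mod_cast G.minDegree_le_degree w
    linarith [hB w (Finset.mem_inter.1 hw).2]
  linarith

variable [Nontrivial V] {K κ : ℝ}

/-- The time to inform a number of further vertices proportional to the minimum degree, if every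
edge boundary has at least `κ` edges. -/
theorem spreadTime_le_of_gain (hG : G.Connected)
    (hΔ : (G.maxDegree : ℝ) ≤ K * G.minDegree) (hK : 1 ≤ K) (hκ : 0 < κ)
    (hcut : ∀ S : Finset V, S.Nonempty → S ≠ Finset.univ → κ ≤ edgeCount G S Sᶜ)
    {m M : ℝ} (hM : 0 ≤ M)
    (h : ∀ J : Finset V, m + (G.minDegree : ℝ) / 32 ≤ J.card → spreadTime G J ≤ ENNReal.ofReal M)
    (I : Finset V) (hI : I.Nonempty) (hI' : I ≠ Finset.univ) (hm : m ≤ I.card) :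
    spreadTime G I ≤ ENNReal.ofReal (1 + 2 * K * G.minDegree / κ +
      128 * K * Real.log (Fintype.card V) + 8 * K + 64 * K ^ 2 * Real.log (edgeCount G I Iᶜ) + M) := by
  have hδ : (0 : ℝ) < G.minDegree := by exact_mod_cast minDegree_pos_of_connected hG
  have hlogn : 0 ≤ Real.log (Fintype.card V : ℝ) := Real.log_natCast_nonneg _
  have hnk : 0 ≤ 2 * K * G.minDegree / κ := by positivity
  have hnl : 0 ≤ 128 * K * Real.log (Fintype.card V) := by positivity
  -- The count `m` stays fixed while `I` grows, so progress made in rounds that only shrink the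
  -- boundary does not move the target.
  induction hN : (Iᶜ).card using Nat.strong_induction_on generalizing I with
  | _ N ih =>
    set k := edgeCount G I Iᶜ with hk
    have hk1 : 1 ≤ k := one_le_edgeCount_compl hG hI hI'
    have hlogk : 0 ≤ 64 * K ^ 2 * Real.log k := mul_nonneg (by positivity) (Real.log_nonneg hk1)
    let B : Finset V := Iᶜ.filter fun w => edgeCount G {w} Iᶜ < (G.minDegree : ℝ) / 8
    let U : Finset V := Iᶜ.filter fun w => ¬ edgeCount G {w} Iᶜ < (G.minDegree : ℝ) / 8
    have hBU : Disjoint B U := Finset.disjoint_filter_filter_not _ _ _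
    have hBUI : B ∪ U = Iᶜ := Finset.filter_union_filter_not_eq _ _
    have hBmem : ∀ w ∈ B, edgeCount G {w} Iᶜ < (G.minDegree : ℝ) / 8 := fun w hw =>
      (Finset.mem_filter.1 hw).2
    have hBI : Disjoint B I := disjoint_compl_left.mono_left (Finset.filter_subset _ _)
    have hUI : Disjoint U I := disjoint_compl_left.mono_left (Finset.filter_subset _ _)
    have hBhalf : ∀ w ∈ B, (G.minDegree : ℝ) / 2 ≤ edgeCount G I {w} := by
      intro w hw
      have h5 : edgeCount G {w} I + edgeCount G {w} Iᶜ = G.degree w := by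
        rw [← edgeCount_union_right disjoint_compl_right, Finset.union_compl,
          edgeCount_singleton_univ]
      have h6 : (G.minDegree : ℝ) ≤ G.degree w := by exact_mod_cast G.minDegree_le_degree w
      rw [edgeCount_comm]
      linarith [hBmem w hw]
    have hcard {J W : Finset V} (hIJ : I ⊆ J) (hW : Disjoint W I) :
        (I.card : ℝ) + (J ∩ W).card ≤ J.card := by
      norm_cast
      rw [← Finset.card_union_of_disjoint (hW.mono_left Finset.inter_subset_right).symm]
      exact Finset.card_le_card (Finset.union_subset hIJ Finset.inter_subset_left)
    have hsd (J : Finset V) : ((B \ J).card : ℝ) + (J ∩ B).card = B.card := by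
      norm_cast
      rw [Finset.inter_comm]
      exact Finset.card_sdiff_add_card_inter B J
    -- Half of a `B` this large already supplies the δ/32 new vertices.
    by_cases hBbig : (G.minDegree : ℝ) / 16 ≤ B.card
    · refine (spreadTime_le_of_half_informed hG hΔ hK hM hBhalf fun J hIJ hJ => h J ?_).trans
        (ENNReal.ofReal_le_ofReal (by linarith))
      linarith [hcard hIJ hBI, hsd J]
    push Not at hBbig
    -- At least δ/8 uninformed neighbours, fewer than δ/16 of them in `B`.
    have hUdeg : ∀ w ∈ U, (G.minDegree : ℝ) / 16 ≤ edgeCount G {w} U := by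
      intro w hw
      have h1 := not_lt.1 (Finset.mem_filter.1 hw).2
      rw [← hBUI, edgeCount_union_right hBU] at h1
      linarith [edgeCount_singleton_le_card (G := G) w B]
    have hgrow {J : Finset V} (hIJ : I ⊆ J) (hJU : (J ∩ U).Nonempty) :
        spreadTime G J ≤ ENNReal.ofReal (128 * K * Real.log (Fintype.card V) + M) :=
      spreadTime_le_of_growth hG hΔ hK hM hUdeg
        (fun J' hIJ' hJ' => h J' (by linarith [hcard hIJ' hUI])) hIJ hJU
    have hksplit : k = edgeCount G I B + edgeCount G I U := by
      rw [hk, ← edgeCount_union_right hBU, hBUI]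
    -- This is the only use of the cut bound κ: at least κ/2 edges lead into `U`, so crossing takes
    -- mean time at most 1 + 2Kδ/κ.
    by_cases hkU : k / 2 ≤ edgeCount G I U
    · refine (spreadTime_le_of_crossing hG (by linarith) (by linarith)
        fun J hIJ hJU => hgrow hIJ hJU).trans (ENNReal.ofReal_le_ofReal ?_)
      have h1 : G.maxDegree / edgeCount G I U ≤ 2 * K * G.minDegree / κ := by
        rw [div_le_div_iff₀ (by linarith) hκ]
        have h2 := hcut I hI hI'
        have h3 : κ ≤ 2 * edgeCount G I U := by linarith
        nlinarith
      linarith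
    push Not at hkU
    have hkB : k / 2 ≤ edgeCount G I B := by linarith
    have hkB' : edgeCount G I B ≤ B.card * (K * G.minDegree) := by
      rw [edgeCount_eq_sum_right, ← nsmul_eq_mul, ← Finset.sum_const]
      refine Finset.sum_le_sum fun w _ => ?_
      rw [edgeCount_comm]
      exact (edgeCount_singleton_le_maxDegree w I).trans hΔ
    have hBpos : (0 : ℝ) < B.card := by
      by_contra hneg
      have : (B.card : ℝ) = 0 := le_antisymm (not_lt.1 hneg) (by positivity)
      rw [this] at hkB'
      linarith
    -- Most of the boundary leads to `B`. The continuation bound omits the cost 8K of this round in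
    -- the case of a further round, where the decrease of the logarithm of the boundary pays for it.
    refine (spreadTime_le_of_half_informed (M := 1 + 2 * K * G.minDegree / κ +
      128 * K * Real.log (Fintype.card V) + 64 * K ^ 2 * Real.log k + M)
      hG hΔ hK (by linarith) hBhalf fun J hIJ hJ => ?_).trans
        (ENNReal.ofReal_le_ofReal (by linarith))
    by_cases hJuniv : J = Finset.univ
    · rw [hJuniv, spreadTime_univ]
      exact bot_le
    by_cases hJU : (J ∩ U).Nonempty
    · exact (hgrow hIJ hJU).trans (ENNReal.ofReal_le_ofReal (by linarith))
    have hJB : J ⊆ I ∪ B := by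
      intro w hw
      by_contra hw'
      simp only [Finset.mem_union, not_or] at hw'
      have : w ∈ B ∪ U := by rw [hBUI]; simpa using hw'.1
      exact hJU ⟨w, Finset.mem_inter.2 ⟨hw, (Finset.mem_union.1 this).resolve_left hw'.2⟩⟩
    have hJBcard : (B.card : ℝ) / 2 ≤ (J ∩ B).card := by linarith [hsd J]
    have hlt : (Jᶜ).card < N := by
      rw [← hN]
      have h1 := hcard hIJ hBI
      have h2 : (I.card : ℝ) < J.card := by linarith
      have h3 : I.card < J.card := by exact_mod_cast h2
      have := Finset.card_add_card_compl I
      have := Finset.card_add_card_compl J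
      omega
    have hJne : J.Nonempty := hI.mono hIJ
    have hk1' : 1 ≤ edgeCount G J Jᶜ := one_le_edgeCount_compl hG hJne hJuniv
    -- From k/2 ≤ |B|Kδ, informing half of `B` removes at least (3/4)δ|B|/2 ≥ 3k/(16K) boundary
    -- edges.
    have hdec : edgeCount G J Jᶜ ≤ k * (1 - 1 / (8 * K)) := by
      have h1 := edgeCount_compl_le_of_bad hIJ hJB hBI hBmem
      have h2 : k / (8 * K) ≤ 3 / 4 * G.minDegree * (J ∩ B).card := by
        rw [div_le_iff₀ (by positivity)]
        nlinarith [mul_le_mul_of_nonneg_left hJBcard (show 0 ≤ K * (G.minDegree : ℝ) by positivity)]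
      have h3 : k * (1 - 1 / (8 * K)) = k - k / (8 * K) := by ring
      linarith
    -- The logarithm drops by at least 1/(8K), and 64K²/(8K) = 8K is the cost of the round.
    have hlog : 64 * K ^ 2 * Real.log (edgeCount G J Jᶜ) + 8 * K ≤ 64 * K ^ 2 * Real.log k := by
      have h0 : 0 < 1 - 1 / (8 * K) := by
        rw [sub_pos, div_lt_one (by positivity)]
        linarith
      have h1 := Real.log_le_log (by linarith) hdec
      rw [Real.log_mul (by linarith) h0.ne'] at h1
      have h2 := Real.log_le_sub_one_of_pos h0
      have h3 : Real.log (edgeCount G J Jᶜ) ≤ Real.log k - 1 / (8 * K) := by linarith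
      have h4 := mul_le_mul_of_nonneg_left h3 (show 0 ≤ 64 * K ^ 2 by positivity)
      have h5 : 64 * K ^ 2 * (Real.log k - 1 / (8 * K)) = 64 * K ^ 2 * Real.log k - 8 * K := by
        field_simp
        ring
      linarith
    refine (ih _ hlt J hJne hJuniv ?_ rfl).trans (ENNReal.ofReal_le_ofReal (by linarith))
    exact hm.trans (by exact_mod_cast Finset.card_le_card hIJ)

theorem log_edgeCount_compl_le (hG : G.Connected) {I : Finset V} (hI : I.Nonempty)
    (hI' : I ≠ Finset.univ) :
    Real.log (edgeCount G I Iᶜ) ≤ 2 * Real.log (Fintype.card V) := by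
  have h1 := one_le_edgeCount_compl hG hI hI'
  have h2 : edgeCount G I Iᶜ ≤ (Fintype.card V : ℝ) ^ 2 := by
    rw [edgeCount_eq_sum_left, sq]
    refine (Finset.sum_le_sum fun u _ => (edgeCount_singleton_le_card u _).trans
      (Nat.cast_le.2 (Finset.card_le_univ _))).trans ?_
    rw [Finset.sum_const, nsmul_eq_mul]
    exact mul_le_mul_of_nonneg_right (Nat.cast_le.2 (Finset.card_le_univ _)) (by positivity)
  have h3 := Real.log_le_log (by linarith) h2
  rwa [Real.log_pow, Nat.cast_ofNat] at h3

/-- Each gain of δ/32 vertices costs at most one factor `τ`, since a boundary has at most n² edges.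
The summand 1 pays for the current phase, and the recursive bound absorbs the rest. -/
theorem spreadTime_le (hG : G.Connected)
    (hΔ : (G.maxDegree : ℝ) ≤ K * G.minDegree) (hK : 1 ≤ K) (hκ : 0 < κ)
    (hcut : ∀ S : Finset V, S.Nonempty → S ≠ Finset.univ → κ ≤ edgeCount G S Sᶜ)
    (I : Finset V) (hI : I.Nonempty) :
    spreadTime G I ≤ ENNReal.ofReal ((1 + 2 * K * G.minDegree / κ +
      128 * K * Real.log (Fintype.card V) + 8 * K + 128 * K ^ 2 * Real.log (Fintype.card V)) *
        (1 + 32 * (Fintype.card V - I.card) / G.minDegree)) := by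
  have hδ : (0 : ℝ) < G.minDegree := by exact_mod_cast minDegree_pos_of_connected hG
  have hlogn : 0 ≤ Real.log (Fintype.card V : ℝ) := Real.log_natCast_nonneg _
  set τ := 1 + 2 * K * G.minDegree / κ +
      128 * K * Real.log (Fintype.card V) + 8 * K + 128 * K ^ 2 * Real.log (Fintype.card V) with hτ
  have hτ0 : 0 ≤ τ := by positivity
  induction hN : (Iᶜ).card using Nat.strong_induction_on generalizing I with
  | _ N ih =>
    by_cases hI' : I = Finset.univ
    · rw [hI', spreadTime_univ]
      exact bot_le
    have hIn : (I.card : ℝ) ≤ Fintype.card V := Nat.cast_le.2 (Finset.card_le_univ _)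
    have hM : 0 ≤ τ * (32 * (Fintype.card V - I.card) / G.minDegree) :=
      mul_nonneg hτ0 (div_nonneg (by linarith) hδ.le)
    refine (spreadTime_le_of_gain hG hΔ hK hκ hcut hM (m := I.card) (fun J hJ => ?_) I hI hI'
      le_rfl).trans (ENNReal.ofReal_le_ofReal ?_)
    · have hlt : I.card < J.card := by
        have : (I.card : ℝ) < J.card := by linarith
        exact_mod_cast this
      have h1 := Finset.card_add_card_compl I
      have h2 := Finset.card_add_card_compl J
      refine (ih (Jᶜ).card (by omega) J (Finset.card_pos.1 (by omega)) rfl).trans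
        (ENNReal.ofReal_le_ofReal (mul_le_mul_of_nonneg_left ?_ hτ0))
      rw [le_div_iff₀ hδ, add_mul, div_mul_cancel₀ _ hδ.ne']
      linarith
    · have h3 := log_edgeCount_compl_le hG hI hI'
      have h4 := mul_le_mul_of_nonneg_left h3 (show 0 ≤ 64 * K ^ 2 by positivity)
      rw [mul_add, mul_one]
      linarith

/-- With κ = nδ/(2b) the crossing cost per phase becomes 4Kb/n, and O(n/δ) phases turn it into
O(b/δ). -/
theorem spreadTime_le_blanketTime (hG : G.Connected)
    (hΔ : (G.maxDegree : ℝ) ≤ K * G.minDegree) (hK : 1 ≤ K) (hb : blanketTime G ≠ ⊤)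
    (I : Finset V) (hI : I.Nonempty) :
    spreadTime G I ≤ ENNReal.ofReal (20000 * K ^ 2 *
      ((blanketTime G).toReal / G.minDegree + (Fintype.card V : ℝ) ^ 2 / (G.minDegree : ℝ) ^ 2 *
        Real.log (Fintype.card V) ^ 2)) := by
  have hδ : (0 : ℝ) < G.minDegree := by exact_mod_cast minDegree_pos_of_connected hG
  have hn2 : (2 : ℝ) ≤ Fintype.card V := by exact_mod_cast Fintype.one_lt_card
  set n : ℝ := (Fintype.card V : ℝ) with hn
  set δ : ℝ := (G.minDegree : ℝ) with hδdef
  set b := (blanketTime G).toReal with hbdef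
  have hδn : δ ≤ n := by
    obtain ⟨v⟩ : Nonempty V := inferInstance
    have h1 := (G.minDegree_le_degree v).trans (G.degree_lt_card_verts v).le
    rw [hδdef, hn]
    exact_mod_cast h1
  have hbpos : 0 < b := by
    obtain ⟨v⟩ : Nonempty V := inferInstance
    have h1 := card_mul_minDegree_le_blanketTime_mul hG (Finset.singleton_nonempty v)
      (Finset.singleton_ne_univ v) hb
    have h2 : 0 < n * δ := by positivity
    have h3 : 0 ≤ b := ENNReal.toReal_nonneg
    rcases h3.eq_or_lt with h3 | h3
    · rw [← hbdef, ← h3] at h1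
      linarith
    · exact h3
  have hlog : 1 / 2 ≤ Real.log n := by
    have := Real.log_le_log (by norm_num) hn2
    linarith [Real.log_two_gt_d9]
  have hcut (S : Finset V) (h1 : S.Nonempty) (h2 : S ≠ Finset.univ) :
      n * δ / (2 * b) ≤ edgeCount G S Sᶜ := by
    rw [div_le_iff₀ (by positivity), mul_comm]
    exact (mul_comm δ n).le.trans (card_mul_minDegree_le_blanketTime_mul hG h1 h2 hb) |>.trans
      (by rw [mul_comm])
  refine (spreadTime_le hG hΔ hK (κ := n * δ / (2 * b)) (by positivity) hcut I hI).trans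
    (ENNReal.ofReal_le_ofReal ?_)
  rw [← hn, ← hδdef]
  set ℓ := Real.log n
  have e1 : 2 * K * δ / (n * δ / (2 * b)) = 4 * K * b / n := by
    field_simp
    ring
  rw [e1]
  have hr : 1 ≤ n / δ := (one_le_div hδ).2 hδn
  -- The number 274 is 128 + 128 + 18, because 1 + 8K ≤ 9K² ≤ 18K²ℓ when ℓ ≥ 1/2.
  have h1 : 1 + 4 * K * b / n + 128 * K * ℓ + 8 * K + 128 * K ^ 2 * ℓ ≤
      4 * K ^ 2 * b / n + 274 * K ^ 2 * ℓ := by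
    have hKK : K ≤ K ^ 2 := by nlinarith
    have a1 : 4 * K * b / n ≤ 4 * K ^ 2 * b / n := by gcongr
    have a2 : K * ℓ ≤ K ^ 2 * ℓ := by gcongr
    have a3 : K ^ 2 * (1 / 2) ≤ K ^ 2 * ℓ := by gcongr
    linarith
  have h2 : 1 + 32 * (n - (I.card : ℝ)) / δ ≤ 33 * (n / δ) := by
    have : 32 * (n - (I.card : ℝ)) / δ ≤ 32 * n / δ := by
      gcongr
      linarith [(Nat.cast_nonneg I.card : (0 : ℝ) ≤ I.card)]
    have e : 32 * n / δ = 32 * (n / δ) := by ring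
    linarith
  have h3 : (1 + 4 * K * b / n + 128 * K * ℓ + 8 * K + 128 * K ^ 2 * ℓ) *
      (1 + 32 * (n - (I.card : ℝ)) / δ) ≤
        (4 * K ^ 2 * b / n + 274 * K ^ 2 * ℓ) * (33 * (n / δ)) :=
    mul_le_mul h1 h2 (by
      have : (I.card : ℝ) ≤ n := Nat.cast_le.2 (Finset.card_le_univ _)
      have : 0 ≤ 32 * (n - (I.card : ℝ)) / δ := div_nonneg (by linarith) hδ.le
      linarith) (by positivity)
  refine h3.trans ?_
  have e2 : (4 * K ^ 2 * b / n + 274 * K ^ 2 * ℓ) * (33 * (n / δ)) =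
      K ^ 2 * (132 * (b / δ)) + K ^ 2 * (9042 * ((n / δ) * ℓ)) := by
    field_simp
    ring
  -- The argument gives (n/δ) log n, which is passed to its square because it is at least 1/2; then
  -- 2 · 9042 ≤ 20000.
  have h4 : (n / δ) * ℓ ≤ 2 * ((n / δ) * ℓ) ^ 2 := by
    have : 1 / 2 ≤ (n / δ) * ℓ := by nlinarith
    nlinarith
  have e3 : n ^ 2 / δ ^ 2 * ℓ ^ 2 = ((n / δ) * ℓ) ^ 2 := by
    rw [mul_pow, div_pow]
  rw [e2, e3, mul_comm (20000 : ℝ), mul_assoc, ← mul_add]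
  refine mul_le_mul_of_nonneg_left ?_ (by positivity)
  have h5 : 0 ≤ b / δ := by positivity
  have h6 : 0 ≤ ((n / δ) * ℓ) ^ 2 := by positivity
  linarith

end Total

end PushBroadcast

end

theorem mainTheorem3 (K : ℝ) :
    ∃ C : ℝ, 0 < C ∧
      ∀ (V : Type*) [Fintype V] [DecidableEq V] [Nontrivial V]
        (G : SimpleGraph V) [DecidableRel G.Adj],
        G.Connected → (G.maxDegree : ℝ) ≤ K * (G.minDegree : ℝ) →
          PushBroadcast.expectedBroadcastTime G ≤
            ENNReal.ofReal C *
              (PushBroadcast.blanketTime G / (G.minDegree : ENNReal) +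
                ENNReal.ofReal
                  ((Fintype.card V : ℝ) ^ 2 / (G.minDegree : ℝ) ^ 2 *
                    Real.log (Fintype.card V : ℝ) ^ 2)) := by
  have hC : 0 < 20000 * max K 1 ^ 2 := by positivity
  refine ⟨20000 * max K 1 ^ 2, hC, ?_⟩
  intro V _ _ _ G _ hG hΔ
  have hδ : 0 < G.minDegree := PushBroadcast.minDegree_pos_of_connected hG
  have hδ' : (0 : ℝ) < G.minDegree := by exact_mod_cast hδ
  have hΔ' : (G.maxDegree : ℝ) ≤ max K 1 * G.minDegree :=
    hΔ.trans (mul_le_mul_of_nonneg_right (le_max_left _ _) hδ'.le)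
  -- An infinite blanket time makes the right-hand side infinite, since C > 0 and δ is finite; the
  -- real-valued estimates need it finite.
  by_cases hb : PushBroadcast.blanketTime G = ⊤
  · rw [hb, ENNReal.top_div_of_ne_top (ENNReal.natCast_ne_top _), top_add,
      ENNReal.mul_top (by simp)]
    exact le_top
  rw [PushBroadcast.expectedBroadcastTime_eq]
  refine iSup_le fun s => ?_
  refine (PushBroadcast.spreadTime_le_blanketTime hG hΔ' (le_max_right _ _) hb {s}
    (Finset.singleton_nonempty s)).trans (le_of_eq ?_)
  rw [ENNReal.ofReal_mul hC.le, ENNReal.ofReal_add (by positivity) (by positivity),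
    ENNReal.ofReal_div_of_pos hδ', ENNReal.ofReal_toReal hb, ENNReal.ofReal_natCast]
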